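/- Let $d\ge 3$ be an integer, let $q(r)=r^{d-1}$, $Q(r)=\int_0^r q(t)\,dt=r^d/d$, $p=2$, $2^*=\frac{2d}{d-2}$, and let $\beta>0$. The weight $q$ satisfies (Q1) $q\in C^1((0,\infty))$, $q\ge 0$ and $q'>0$ on $(0,\infty)$; (Q2) $q'/q$ is strictly decreasing on $(0,\infty)$; (Q3) there are $C_1,C_2>0$ with $C_1\le r\,q'(r)/q(r)\le C_2$ for all $r>0$; (Q4) for every $r_0>0$, $\lim_{r\to+\infty}\big[q(r+r_0)^2-q(r)^2\big]=+\infty$. Moreover, there exist an odd function $f:\mathbb R\to\mathbb R$ with $f(s)=|s|^{2^*-2}s$ for all $|s|\ge\beta$ and a number $\lambda_0>\beta$ with the following properties, where $F(s)=\int_0^s f(t)\,dt$: (f1) $f$ is continuous on $\mathbb R$, locally Lipschitz on $\mathbb R\setminus\{0\}$, and $f(0)=0$; (f2) $F(s)<0$ for all $s\in(-\beta,\beta)\setminus\{0\}$, $F(\pm\beta)=0$, $f>0$ on $[\beta,\infty)$, $f<0$ on $(-\infty,-\beta]$, and $F(\infty)=F(-\infty)$; the following sub-criticality condition (SC) fails: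 with $\mu^*:=\max\big\{\tfrac12-\liminf_{r\to0^+}(Q/q)'(r),\,0\big\}$, there exist $\alpha\in(0,1)$, $\mu\ge\mu^*$ and $r_0>0$ such that $\mu+(Q/q)'-\tfrac12\ge0$ on $(0,r_0)$ and $$\lim_{s\to+\infty}\ \inf_{s_1,s_2\in[\alpha s,s]}\big(F(s_2)-\mu\,s_2f(s_2)\big)\,Q\Big(\big(\tfrac{(1-\alpha)s}{f(s_1)}\big)^{1/2}\Big)=+\infty\,;$$ and for every $\lambda\ge\lambda_0$ the initial value problem $$\big(q(r)\,v'\big)'+q(r)\,f(v)=0\quad (r>0),\qquad v(0)=\lambda,\quad v'(0)=0,$$ has a unique classical solution $v_\lambda$ on $[0,\infty)$ (that is, $v_\lambda\in C^1([0,\infty))$ and $q\,v_\lambda'\in C^1((0,\infty))$), and $v_\lambda(r)>0$ for all $r\ge0$. Thus (Q1)-(Q4) and (f1)-(f2) hold, only (SC) fails, and no solution with $\lambda\ge\lambda_0$ has a zero. -/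

import Mathlib

open Set Filter Topology

noncomputable section

namespace RadialShooting

/-- The function `φ_p(s) = |s|^(p-2) s`, with `φ_p(0) = 0`. -/
def phi (p s : ℝ) : ℝ := |s| ^ (p - 2) * s

/-- The primitive `F(s) = ∫₀ˢ f(t) dt` of the nonlinearity; also used for `Q(r) = ∫₀ʳ q(t) dt`. -/
def primitive (g : ℝ → ℝ) (s : ℝ) : ℝ := ∫ t in (0 : ℝ)..s, g t

/-- Condition (Q1) on the weight. -/
structure CondQ1 (q : ℝ → ℝ) : Prop where
  contDiffOn : ContDiffOn ℝ 1 q (Ioi 0)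
  nonneg : ∀ r > 0, 0 ≤ q r
  deriv_pos : ∀ r > 0, 0 < deriv q r

/-- Condition (Q2): `q'/q` is strictly decreasing on `(0,∞)`. -/
def CondQ2 (q : ℝ → ℝ) : Prop := StrictAntiOn (fun r => deriv q r / q r) (Ioi 0)

/-- Condition (Q3): `C₁ ≤ r q'(r)/q(r) ≤ C₂` on `(0,∞)`. -/
def CondQ3 (q : ℝ → ℝ) : Prop :=
  ∃ C₁ > 0, ∃ C₂ > 0, ∀ r > 0, C₁ ≤ r * deriv q r / q r ∧ r * deriv q r / q r ≤ C₂

/-- Condition (Q4): with `h = q^{p'}` and `p' = p/(p-1)`, `h(r+r₀) - h(r) → +∞` as `r → +∞`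
for every `r₀ > 0`. -/
def CondQ4 (p : ℝ) (q : ℝ → ℝ) : Prop :=
  ∀ r₀ > 0, Tendsto
    (fun r => q (r + r₀) ^ Real.conjExponent p - q r ^ Real.conjExponent p) atTop atTop

/-- Condition (f1): `f` is continuous on `ℝ`, locally Lipschitz on `ℝ ∖ {0}`, and `f(0) = 0`. -/
structure CondF1 (f : ℝ → ℝ) : Prop where
  continuous : Continuous f
  locallyLipschitzOn : LocallyLipschitzOn {0}ᶜ f
  map_zero : f 0 = 0

/-- Condition (f2), with the given values of `β⁻` and `β⁺`. The last field is `F(∞) = F(-∞)`,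
where the common value may be infinite. -/
structure CondF2 (f : ℝ → ℝ) (βm βp : ℝ) : Prop where
  neg_lt : βm < 0
  pos_lt : 0 < βp
  primitive_neg : ∀ s ∈ Ioo βm βp, s ≠ 0 → primitive f s < 0
  primitive_left : primitive f βm = 0
  primitive_right : primitive f βp = 0
  pos_right : ∀ s, βp ≤ s → 0 < f s
  neg_left : ∀ s, s ≤ βm → f s < 0
  primitive_infty : ∃ L : EReal,
    Tendsto (fun s => (primitive f s : EReal)) atTop (𝓝 L) ∧
    Tendsto (fun s => (primitive f s : EReal)) atBot (𝓝 L)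

/-- `μ* = [1/p - 1/N]₊`, where `1/N = liminf_{r → 0⁺} (Q/q)'(r)`. -/
def muStar (p : ℝ) (q : ℝ → ℝ) : ℝ :=
  max (1 / p - liminf (deriv fun t => primitive q t / q t) (𝓝[>] 0)) 0

/-- The sub-criticality condition (SC). -/
def CondSC (p : ℝ) (q f : ℝ → ℝ) : Prop :=
  ∃ α ∈ Ioo (0 : ℝ) 1, ∃ μ ≥ muStar p q, ∃ r₀ > 0,
    (∀ r ∈ Ioo 0 r₀, 0 ≤ μ + deriv (fun t => primitive q t / q t) r - 1 / p) ∧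
    Tendsto
      (fun s => sInf {x : ℝ | ∃ s₁ ∈ Icc (α * s) s, ∃ s₂ ∈ Icc (α * s) s,
        x = (primitive f s₂ - μ * s₂ * f s₂) *
          primitive q (((1 - α) * s / phi (Real.conjExponent p) (f s₁)) ^
            (1 / Real.conjExponent p))})
      atTop atTop

/-- `v` is a classical solution on `[0,∞)` of the initial value problem
`(q φ_p(v'))' + q f(v) = 0` for `r > 0`, `v(0) = l`, `v'(0) = 0`. Only the values of `v` on
`[0,∞)` are relevant. -/
structure IsIVPSolution (p : ℝ) (q f : ℝ → ℝ) (l : ℝ) (v : ℝ → ℝ) : Prop where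
  contDiffOn : ContDiffOn ℝ 1 v (Ici 0)
  flux_contDiffOn : ContDiffOn ℝ 1 (fun r => q r * phi p (deriv v r)) (Ioi 0)
  equation : ∀ r > 0, deriv (fun t => q t * phi p (deriv v t)) r + q r * f (v r) = 0
  init_value : v 0 = l
  init_deriv : derivWithin v (Ici 0) 0 = 0

/-- The critical exponent `2* = 2d/(d-2)`. -/
def twoStar (d : ℕ) : ℝ := 2 * (d : ℝ) / ((d : ℝ) - 2)

/-- The radial weight `q(r) = r^(d-1)`. -/
def radialWeight (d : ℕ) : ℝ → ℝ := fun r => r ^ (d - 1)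

end RadialShooting

end

/-!
Write `p = 2* = 2d/(d-2)`. The nonlinearity is chosen so that `F(s) = |s|^p (|s|/β - 1)` for
`|s| ≤ β` and `f(s) = |s|^(p-2) s` for `|s| ≥ β` (`glueNonlinearity`). The two formulas match at
`|s| = β`, `F` vanishes there and is negative in between, and `F(s)/s^p` is strictly increasing on
`(0, ∞)`, that is, `p F(s) < s f(s)` for all `s > 0` (`primitive_glueNonlinearity_lt`).

This one inequality gives both negative assertions. Since `Q/q = r/d`, the threshold is
`μ* = 1/2 - 1/d = 1/p`, so `F(s) - μ s f(s) < 0` for `μ ≥ μ*` and large `s`, and the infimum in the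
sub-criticality condition is nonpositive (`not_condSC_of_primitive_le`). Along a solution, the
Pohozaev function `r^d (v'²/2 + F(v)) + ((d-2)/2) r^(d-1) v v'` has derivative
`r^(d-1) (d F(v) - ((d-2)/2) v f(v))`, which is negative while `v > 0`. It starts from zero, so it
is negative at a first zero `r` of `v`, where however it equals `r^d v'(r)²/2 ≥ 0`. Hence positive
solutions stay positive (`pos_of_isRadialSol`).

For existence with `v(0) = l > β`, the Aubin–Talenti bubble is an explicit solution as long as it
stays above `β`, which disposes of the singularity at `r = 0`. From there on the Picard–Lindelöf
theorem applies to a truncated equation, and the energy `v'²/2 + F(v)`, which is nonincreasing,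
keeps `|v| ≤ l`, where the truncation is not felt (`IsRadialSol.exists_extension`). Uniqueness holds
from `r = 0` on because the singular damping term has the favourable sign in the Gronwall estimate
for the squared distance of two solutions in the phase plane (`IsRadialSol.eqOn`).
-/

namespace RadialShooting

/-! ### Weight -/

lemma phi_two (s : ℝ) : phi 2 s = s := by
  simp [phi]

lemma conjExponent_two : Real.conjExponent 2 = 2 := by
  norm_num [Real.conjExponent]

lemma hasDerivAt_radialWeight {d : ℕ} (hd : 2 ≤ d) {r : ℝ} (hr : r ≠ 0) :
    HasDerivAt (radialWeight d) (((d : ℝ) - 1) / r * r ^ (d - 1)) r := by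
  obtain ⟨k, rfl⟩ := Nat.exists_eq_add_of_le' hd
  refine (hasDerivAt_pow (k + 1) r).congr_deriv ?_
  rw [show k + 2 - 1 = k + 1 from rfl, Nat.add_sub_cancel]
  push_cast
  field_simp
  ring

lemma condQ1_radialWeight {d : ℕ} (hd : 2 ≤ d) : CondQ1 (radialWeight d) where
  contDiffOn := (contDiff_id.pow _).contDiffOn
  nonneg r hr := pow_nonneg hr.le _
  deriv_pos r hr := by
    rw [(hasDerivAt_radialWeight hd hr.ne').deriv]
    have : (2 : ℝ) ≤ d := by exact_mod_cast hd
    have : (0 : ℝ) < d - 1 := by linarith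
    positivity

lemma deriv_radialWeight_div {d : ℕ} (hd : 2 ≤ d) {r : ℝ} (hr : 0 < r) :
    deriv (radialWeight d) r / radialWeight d r = ((d : ℝ) - 1) / r := by
  rw [(hasDerivAt_radialWeight hd hr.ne').deriv, radialWeight]
  field_simp

lemma condQ2_radialWeight {d : ℕ} (hd : 2 ≤ d) : CondQ2 (radialWeight d) := by
  intro r hr s hs hrs
  have : (2 : ℝ) ≤ d := by exact_mod_cast hd
  simp only [deriv_radialWeight_div hd (mem_Ioi.1 hr), deriv_radialWeight_div hd (mem_Ioi.1 hs)]
  exact div_lt_div_of_pos_left (by linarith) hr hrs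

lemma condQ3_radialWeight {d : ℕ} (hd : 2 ≤ d) : CondQ3 (radialWeight d) := by
  have : (2 : ℝ) ≤ d := by exact_mod_cast hd
  refine ⟨d - 1, by linarith, d - 1, by linarith, fun r hr => ?_⟩
  have : r * deriv (radialWeight d) r / radialWeight d r = d - 1 := by
    rw [mul_div_assoc, deriv_radialWeight_div hd hr]
    field_simp
  exact ⟨this.ge, this.le⟩

lemma condQ4_radialWeight {d : ℕ} (hd : 2 ≤ d) : CondQ4 2 (radialWeight d) := by
  obtain ⟨k, rfl⟩ := Nat.exists_eq_add_of_le' hd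
  intro r₀ hr₀
  simp only [conjExponent_two, Real.rpow_two, radialWeight, show k + 2 - 1 = k + 1 from rfl]
  have hlin : Tendsto (fun r : ℝ => 2 * r₀ * r) atTop atTop :=
    tendsto_id.const_mul_atTop (by positivity)
  refine tendsto_atTop_mono' _ ?_ hlin
  filter_upwards [eventually_ge_atTop 1] with r hr
  -- `(r + r₀)^(2k+2) ≥ r^(2k) (r + r₀)²`, and `r^(2k) ≥ 1`.
  have h1 : (1 : ℝ) ≤ (r ^ k) ^ 2 := one_le_pow₀ (one_le_pow₀ hr)
  have h2 : (r ^ k) ^ 2 ≤ ((r + r₀) ^ k) ^ 2 := by gcongr; linarith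
  have h3 : 2 * r₀ * r ≤ (r + r₀) ^ 2 - r ^ 2 := by nlinarith
  calc 2 * r₀ * r ≤ 1 * ((r + r₀) ^ 2 - r ^ 2) := by linarith
    _ ≤ (r ^ k) ^ 2 * ((r + r₀) ^ 2 - r ^ 2) := by
        apply mul_le_mul_of_nonneg_right h1
        have : 0 ≤ 2 * r₀ * r := by positivity
        linarith
    _ = (r ^ k) ^ 2 * (r + r₀) ^ 2 - (r ^ (k + 1)) ^ 2 := by ring
    _ ≤ ((r + r₀) ^ k) ^ 2 * (r + r₀) ^ 2 - (r ^ (k + 1)) ^ 2 := by gcongr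
    _ = ((r + r₀) ^ (k + 1)) ^ 2 - (r ^ (k + 1)) ^ 2 := by ring

lemma primitive_radialWeight {d : ℕ} (hd : 1 ≤ d) (r : ℝ) :
    primitive (radialWeight d) r = r ^ d / d := by
  obtain ⟨k, rfl⟩ := Nat.exists_eq_add_of_le' hd
  simp [primitive, radialWeight, integral_pow]

lemma deriv_primitive_div_radialWeight {d : ℕ} (hd : 1 ≤ d) {r : ℝ} (hr : 0 < r) :
    deriv (fun t => primitive (radialWeight d) t / radialWeight d t) r = 1 / d := by
  have : (fun t => primitive (radialWeight d) t / radialWeight d t) =ᶠ[𝓝 r]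
      fun t => t / d := by
    filter_upwards [lt_mem_nhds hr] with t ht
    obtain ⟨k, rfl⟩ := Nat.exists_eq_add_of_le' hd
    rw [primitive_radialWeight hd, radialWeight, Nat.add_sub_cancel, pow_succ]
    field_simp
  rw [this.deriv_eq]
  simp

lemma muStar_two_radialWeight {d : ℕ} (hd : 2 ≤ d) :
    muStar 2 (radialWeight d) = 1 / 2 - 1 / d := by
  have h : liminf (deriv fun t => primitive (radialWeight d) t / radialWeight d t) (𝓝[>] 0)
      = 1 / d := by
    rw [liminf_congr (v := fun _ => (1 / d : ℝ)), liminf_const]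
    filter_upwards [self_mem_nhdsWithin] with r hr
    exact deriv_primitive_div_radialWeight (by omega) hr
  have : (2 : ℝ) ≤ d := by exact_mod_cast hd
  rw [muStar, h, max_eq_left]
  rw [sub_nonneg]
  exact one_div_le_one_div_of_le (by norm_num) this

/-! ### Nonlinearity -/

/-- The function `|s|^(p-2) s κ(|s|)` with `κ(t) = (p+1) min(t/β, 1) - p`: it is the pure power
`|s|^(p-2) s` for `|s| ≥ β`, and its primitive is `|s|^p (|s|/β - 1)` for `|s| ≤ β`. -/
noncomputable def glueNonlinearity (p β s : ℝ) : ℝ :=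
  |s| ^ (p - 2) * s * ((p + 1) * min (|s| / β) 1 - p)

section Nonlinearity

variable {p β : ℝ}

lemma odd_glueNonlinearity : Function.Odd (glueNonlinearity p β) := by
  intro s
  simp [glueNonlinearity]

lemma glueNonlinearity_of_le_abs (hβ : 0 < β) {s : ℝ} (hs : β ≤ |s|) :
    glueNonlinearity p β s = |s| ^ (p - 2) * s := by
  rw [glueNonlinearity, min_eq_right ((one_le_div hβ).2 hs)]
  ring

lemma abs_rpow_mul_of_nonneg (hp : 2 < p) {s : ℝ} (hs : 0 ≤ s) :
    |s| ^ (p - 2) * s = s ^ (p - 1) := by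
  rw [abs_of_nonneg hs]
  nth_rw 2 [← Real.rpow_one s]
  rw [← Real.rpow_add_of_nonneg hs (by linarith) (by norm_num)]
  ring_nf

lemma glueNonlinearity_of_le (hp : 2 < p) (hβ : 0 < β) {s : ℝ} (hs : β ≤ s) :
    glueNonlinearity p β s = s ^ (p - 1) := by
  have h0 : 0 ≤ s := hβ.le.trans hs
  rw [glueNonlinearity_of_le_abs hβ (by rwa [abs_of_nonneg h0]), abs_rpow_mul_of_nonneg hp h0]

lemma glueNonlinearity_of_mem_Icc (hp : 2 < p) (hβ : 0 < β) {s : ℝ} (hs : s ∈ Icc 0 β) :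
    glueNonlinearity p β s = (p + 1) / β * s ^ p - p * s ^ (p - 1) := by
  rw [glueNonlinearity, abs_rpow_mul_of_nonneg hp hs.1, abs_of_nonneg hs.1,
    min_eq_left ((div_le_one hβ).2 hs.2)]
  have : s ^ p = s ^ (p - 1) * s := by
    nth_rw 3 [← Real.rpow_one s]
    rw [← Real.rpow_add_of_nonneg hs.1 (by linarith) (by norm_num)]
    ring_nf
  rw [this]
  ring

lemma locallyLipschitz_abs_rpow_mul (hp : 2 < p) :
    LocallyLipschitz fun s : ℝ => |s| ^ (p - 2) * s := by
  have hpow : LocallyLipschitz fun s : ℝ => s ^ (p - 1) :=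
    ContDiff.locallyLipschitz (𝕂 := ℝ)
      (Real.contDiff_rpow_const_of_le (n := 1) (by norm_num; linarith))
  have h : (fun s : ℝ => |s| ^ (p - 2) * s) =
      fun s => (max s 0) ^ (p - 1) - (max (-s) 0) ^ (p - 1) := by
    funext s
    have h0 : (0 : ℝ) ^ (p - 1) = 0 := Real.zero_rpow (by linarith)
    rcases le_total 0 s with hs | hs
    · rw [abs_rpow_mul_of_nonneg hp hs, max_eq_left hs, max_eq_right (neg_nonpos.2 hs), h0,
        sub_zero]
    · have := abs_rpow_mul_of_nonneg hp (neg_nonneg.2 hs)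
      rw [max_eq_right hs, max_eq_left (neg_nonneg.2 hs), h0, ← this, abs_neg]
      ring
  rw [h]
  exact (hpow.comp (LocallyLipschitz.id.max_const 0)).sub
    (hpow.comp ((contDiff_neg.locallyLipschitz (𝕂 := ℝ)).max_const 0))

lemma locallyLipschitz_glueNonlinearity (hp : 2 < p) :
    LocallyLipschitz (glueNonlinearity p β) := by
  have hpoly : LocallyLipschitz fun x : ℝ × ℝ => x.1 * ((p + 1) * x.2 - p) :=
    ContDiff.locallyLipschitz (𝕂 := ℝ) (by fun_prop)
  have hmin : LocallyLipschitz fun s : ℝ => min (|s| / β) 1 := by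
    have habs : LocallyLipschitz fun s : ℝ => |s| := lipschitzWith_one_norm.locallyLipschitz
    have hdiv : LocallyLipschitz fun s : ℝ => s / β :=
      ContDiff.locallyLipschitz (𝕂 := ℝ) (by fun_prop)
    exact (hdiv.comp habs).min_const 1
  exact hpoly.comp ((locallyLipschitz_abs_rpow_mul hp).prodMk hmin)

lemma continuous_glueNonlinearity (hp : 2 < p) : Continuous (glueNonlinearity p β) :=
  (locallyLipschitz_glueNonlinearity hp).continuous

lemma condF1_glueNonlinearity (hp : 2 < p) : CondF1 (glueNonlinearity p β) where
  continuous := continuous_glueNonlinearity hp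
  locallyLipschitzOn := (locallyLipschitz_glueNonlinearity hp).locallyLipschitzOn
  map_zero := by simp [glueNonlinearity]

lemma primitive_neg_of_odd {f : ℝ → ℝ} (hf : Function.Odd f) (s : ℝ) :
    primitive f (-s) = primitive f s := by
  have := intervalIntegral.integral_comp_neg (a := 0) (b := s) f
  simp only [hf _, intervalIntegral.integral_neg, neg_zero] at this
  rw [primitive, primitive, intervalIntegral.integral_symm, ← this, neg_neg]

lemma hasDerivAt_primitive {f : ℝ → ℝ} (hf : Continuous f) (s : ℝ) :
    HasDerivAt (primitive f) (f s) s :=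
  intervalIntegral.integral_hasDerivAt_right (hf.intervalIntegrable _ _)
    (hf.stronglyMeasurableAtFilter _ _) hf.continuousAt

lemma primitive_glueNonlinearity_of_mem_Icc (hp : 2 < p) (hβ : 0 < β) {s : ℝ}
    (hs : s ∈ Icc 0 β) : primitive (glueNonlinearity p β) s = s ^ p * (s / β - 1) := by
  have h : primitive (glueNonlinearity p β) s =
      ∫ t in (0 : ℝ)..s, ((p + 1) / β * t ^ p - p * t ^ (p - 1)) := by
    refine intervalIntegral.integral_congr fun t ht => ?_
    rw [uIcc_of_le hs.1] at ht
    exact glueNonlinearity_of_mem_Icc hp hβ ⟨ht.1, ht.2.trans hs.2⟩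
  rw [h, intervalIntegral.integral_sub, intervalIntegral.integral_const_mul,
    intervalIntegral.integral_const_mul, integral_rpow (Or.inl (by linarith)),
    integral_rpow (Or.inl (by linarith)), Real.zero_rpow (by linarith),
    Real.zero_rpow (by linarith), sub_add_cancel,
    Real.rpow_add_one' hs.1 (by linarith)]
  · have : p ≠ 0 := by linarith
    have : p + 1 ≠ 0 := by linarith
    field_simp
    ring
  · exact (intervalIntegral.intervalIntegrable_rpow' (by linarith)).const_mul _
  · exact (intervalIntegral.intervalIntegrable_rpow' (by linarith)).const_mul _

lemma primitive_glueNonlinearity_of_le (hp : 2 < p) (hβ : 0 < β) {s : ℝ} (hs : β ≤ s) :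
    primitive (glueNonlinearity p β) s = (s ^ p - β ^ p) / p := by
  have hc : Continuous (glueNonlinearity p β) := continuous_glueNonlinearity hp
  have h : ∫ t in β..s, glueNonlinearity p β t = ∫ t in β..s, t ^ (p - 1) := by
    refine intervalIntegral.integral_congr fun t ht => ?_
    rw [uIcc_of_le hs] at ht
    exact glueNonlinearity_of_le hp hβ ht.1
  have h0 : primitive (glueNonlinearity p β) β = 0 := by
    rw [primitive_glueNonlinearity_of_mem_Icc hp hβ ⟨hβ.le, le_rfl⟩, div_self hβ.ne']
    ring
  rw [primitive, ← intervalIntegral.integral_add_adjacent_intervals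
    (hc.intervalIntegrable 0 β) (hc.intervalIntegrable β s), h,
    integral_rpow (Or.inl (by linarith)), sub_add_cancel]
  rw [primitive] at h0
  rw [h0, zero_add]

/-- The strict Pohozaev sign condition: `F(s)/s^p` is strictly increasing. -/
lemma primitive_glueNonlinearity_lt (hp : 2 < p) (hβ : 0 < β) {s : ℝ} (hs : 0 < s) :
    p * primitive (glueNonlinearity p β) s < s * glueNonlinearity p β s := by
  have hsp : s * s ^ (p - 1) = s ^ p := by
    rw [mul_comm, ← Real.rpow_add_one hs.ne', sub_add_cancel]
  rcases le_total s β with h | h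
  · rw [primitive_glueNonlinearity_of_mem_Icc hp hβ ⟨hs.le, h⟩,
      glueNonlinearity_of_mem_Icc hp hβ ⟨hs.le, h⟩]
    have h1 : s * ((p + 1) / β * s ^ p - p * s ^ (p - 1)) =
        (p + 1) / β * s * s ^ p - p * (s * s ^ (p - 1)) := by ring
    rw [h1, hsp, ← sub_pos]
    have : (p + 1) / β * s * s ^ p - p * s ^ p - p * (s ^ p * (s / β - 1)) = s / β * s ^ p := by
      field_simp
      ring
    rw [this]
    positivity
  · rw [primitive_glueNonlinearity_of_le hp hβ h, glueNonlinearity_of_le hp hβ h, hsp,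
      mul_div_cancel₀ _ (by linarith)]
    have : 0 < β ^ p := by positivity
    linarith

lemma condF2_glueNonlinearity (hp : 2 < p) (hβ : 0 < β) :
    CondF2 (glueNonlinearity p β) (-β) β := by
  have hpos : ∀ s, 0 < s → s < β → primitive (glueNonlinearity p β) s < 0 := by
    intro s h0 h1
    rw [primitive_glueNonlinearity_of_mem_Icc hp hβ ⟨h0.le, h1.le⟩]
    exact mul_neg_of_pos_of_neg (by positivity) (sub_neg.2 ((div_lt_one hβ).2 h1))
  have h0 : primitive (glueNonlinearity p β) β = 0 := by
    rw [primitive_glueNonlinearity_of_le hp hβ le_rfl, sub_self, zero_div]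
  have hfpos : ∀ s, β ≤ s → 0 < glueNonlinearity p β s := by
    intro s hs
    rw [glueNonlinearity_of_le hp hβ hs]
    exact Real.rpow_pos_of_pos (hβ.trans_le hs) _
  have htop : Tendsto (primitive (glueNonlinearity p β)) atTop atTop := by
    have h1 : Tendsto (fun s : ℝ => (s ^ p - β ^ p) / p) atTop atTop :=
      (tendsto_atTop_add_const_right _ _ (tendsto_rpow_atTop (by linarith))).atTop_div_const
        (by linarith)
    refine h1.congr' ?_
    filter_upwards [eventually_ge_atTop β] with s hs
    exact (primitive_glueNonlinearity_of_le hp hβ hs).symm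
  refine ⟨by linarith, hβ, ?_, ?_, h0, hfpos, ?_, ⊤, ?_, ?_⟩
  · intro s hs hs0
    rcases lt_or_gt_of_ne hs0 with h | h
    · rw [← primitive_neg_of_odd odd_glueNonlinearity]
      exact hpos _ (by linarith) (by linarith [hs.1])
    · exact hpos s h hs.2
  · rw [primitive_neg_of_odd odd_glueNonlinearity, h0]
  · intro s hs
    have := hfpos (-s) (by linarith)
    rw [odd_glueNonlinearity] at this
    linarith
  · exact EReal.tendsto_coe_nhds_top_iff.2 htop
  · refine EReal.tendsto_coe_nhds_top_iff.2 ?_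
    refine (htop.comp tendsto_neg_atBot_atTop).congr fun s => ?_
    exact primitive_neg_of_odd odd_glueNonlinearity s

end Nonlinearity

/-- Sub-criticality fails whenever `F(s) ≤ μ* s f(s)` and `f(s) > 0` for large `s`, because the
infimum in the condition is then nonpositive. -/
lemma not_condSC_of_primitive_le {d : ℕ} (hd : 2 ≤ d) {f : ℝ → ℝ} {β : ℝ} (hβ : 0 < β)
    (hf : ∀ s, β ≤ s → 0 < f s)
    (hF : ∀ s, β ≤ s → primitive f s ≤ (1 / 2 - 1 / d) * s * f s) :
    ¬ CondSC 2 (radialWeight d) f := by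
  rintro ⟨α, hα, μ, hμ, r₀, -, -, hlim⟩
  rw [muStar_two_radialWeight hd] at hμ
  obtain ⟨s, hs1, hs⟩ := ((hlim.eventually_ge_atTop 1).and (eventually_ge_atTop (β / α))).exists
  refine absurd hs1 (not_le.2 (lt_of_le_of_lt (Real.sInf_nonpos ?_) one_pos))
  rintro x ⟨s₁, hs₁, s₂, hs₂, rfl⟩
  have hαs : β ≤ α * s := by rwa [div_le_iff₀' hα.1] at hs
  have hs₂β : β ≤ s₂ := hαs.trans hs₂.1
  have hs0 : 0 ≤ s := (div_nonneg hβ.le hα.1.le).trans hs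
  refine mul_nonpos_of_nonpos_of_nonneg ?_ ?_
  · have h1 : (1 / 2 - 1 / d) * (s₂ * f s₂) ≤ μ * (s₂ * f s₂) :=
      mul_le_mul_of_nonneg_right hμ (mul_nonneg (hβ.le.trans hs₂β) (hf _ hs₂β).le)
    have h2 := hF s₂ hs₂β
    linarith
  · have h1 : 0 < f s₁ := hf _ (hαs.trans hs₁.1)
    rw [conjExponent_two, phi_two, primitive_radialWeight (by omega)]
    have : 0 ≤ (1 - α) * s / f s₁ := div_nonneg (mul_nonneg (by linarith [hα.2]) hs0) h1.le
    positivity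

/-! ### Radial solutions as first-order systems -/

/-- The pair `(v, u)` solves `v' = u`, `u' = -((d-1)/r) u - f(v)` on the interval `(a, b)` and is
continuous up to the end points. For `a = 0` nothing is required of the singular coefficient at
`r = 0` beyond continuity of `u`. -/
structure IsRadialSol (d : ℕ) (f : ℝ → ℝ) (a b : ℝ) (v u : ℝ → ℝ) : Prop where
  continuousOn_fst : ContinuousOn v (Icc a b)
  continuousOn_snd : ContinuousOn u (Icc a b)
  hasDerivAt_fst : ∀ r ∈ Ioo a b, HasDerivAt v (u r) r
  hasDerivAt_snd : ∀ r ∈ Ioo a b, HasDerivAt u (-(((d : ℝ) - 1) / r * u r) - f (v r)) r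

namespace IsRadialSol

variable {d : ℕ} {f g : ℝ → ℝ} {a b a' b' : ℝ} {v u v₁ u₁ v₂ u₂ : ℝ → ℝ}

lemma mono (h : IsRadialSol d f a b v u) (ha : a ≤ a') (hb : b' ≤ b) :
    IsRadialSol d f a' b' v u where
  continuousOn_fst := h.continuousOn_fst.mono (Icc_subset_Icc ha hb)
  continuousOn_snd := h.continuousOn_snd.mono (Icc_subset_Icc ha hb)
  hasDerivAt_fst r hr := h.hasDerivAt_fst r (Ioo_subset_Ioo ha hb hr)
  hasDerivAt_snd r hr := h.hasDerivAt_snd r (Ioo_subset_Ioo ha hb hr)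

lemma congr (h : IsRadialSol d f a b v u) (hv : EqOn v₁ v (Icc a b)) (hu : EqOn u₁ u (Icc a b)) :
    IsRadialSol d f a b v₁ u₁ where
  continuousOn_fst := h.continuousOn_fst.congr hv
  continuousOn_snd := h.continuousOn_snd.congr hu
  hasDerivAt_fst r hr := by
    rw [hu (Ioo_subset_Icc_self hr)]
    exact (h.hasDerivAt_fst r hr).congr_of_eventuallyEq
      (hv.eventuallyEq_of_mem (Icc_mem_nhds hr.1 hr.2))
  hasDerivAt_snd r hr := by
    rw [hu (Ioo_subset_Icc_self hr), hv (Ioo_subset_Icc_self hr)]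
    exact (h.hasDerivAt_snd r hr).congr_of_eventuallyEq
      (hu.eventuallyEq_of_mem (Icc_mem_nhds hr.1 hr.2))

lemma congr_nonlinearity (h : IsRadialSol d f a b v u) (hfg : ∀ r ∈ Ioo a b, g (v r) = f (v r)) :
    IsRadialSol d g a b v u where
  continuousOn_fst := h.continuousOn_fst
  continuousOn_snd := h.continuousOn_snd
  hasDerivAt_fst := h.hasDerivAt_fst
  hasDerivAt_snd r hr := by
    rw [hfg r hr]
    exact h.hasDerivAt_snd r hr

/-- A pair that is a solution on two overlapping intervals is a solution on their union. -/
lemma union (h₁ : IsRadialSol d f a b v u) (h₂ : IsRadialSol d f a' b' v u)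
    (ha : a ≤ a') (hab : a' < b) (hb : b ≤ b') : IsRadialSol d f a b' v u := by
  have hU : Icc a b' = Icc a b ∪ Icc a' b' := by
    rw [Icc_union_Icc' hab.le (by linarith), min_eq_left ha, max_eq_right hb]
  have hcases : ∀ r ∈ Ioo a b', r ∈ Ioo a b ∨ r ∈ Ioo a' b' := by
    intro r hr
    rcases lt_or_ge r b with h | h
    · exact Or.inl ⟨hr.1, h⟩
    · exact Or.inr ⟨hab.trans_le h, hr.2⟩
  refine ⟨?_, ?_, fun r hr => ?_, fun r hr => ?_⟩
  · rw [hU]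
    exact h₁.continuousOn_fst.union_of_isClosed h₂.continuousOn_fst isClosed_Icc isClosed_Icc
  · rw [hU]
    exact h₁.continuousOn_snd.union_of_isClosed h₂.continuousOn_snd isClosed_Icc isClosed_Icc
  · exact (hcases r hr).elim (h₁.hasDerivAt_fst r) (h₂.hasDerivAt_fst r)
  · exact (hcases r hr).elim (h₁.hasDerivAt_snd r) (h₂.hasDerivAt_snd r)

/-- Forward uniqueness, including the singular case `a = 0`: the damping term `-((d-1)/r) u` has
the favourable sign in the differential inequality for `|v₁ - v₂|² + |u₁ - u₂|²`. -/
theorem eqOn (hd : 1 ≤ d) (hf : LocallyLipschitz f) (ha : 0 ≤ a)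
    (h₁ : IsRadialSol d f a b v₁ u₁) (h₂ : IsRadialSol d f a b v₂ u₂)
    (hv : v₁ a = v₂ a) (hu : u₁ a = u₂ a) :
    EqOn v₁ v₂ (Icc a b) ∧ EqOn u₁ u₂ (Icc a b) := by
  have hd1 : (0 : ℝ) ≤ (d : ℝ) - 1 := by
    have : (1 : ℝ) ≤ d := by exact_mod_cast hd
    linarith
  obtain ⟨K, hK⟩ := hf.locallyLipschitzOn.exists_lipschitzOnWith_of_compact
    ((isCompact_Icc.image_of_continuousOn h₁.continuousOn_fst).union
      (isCompact_Icc.image_of_continuousOn h₂.continuousOn_fst))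
  have hlip : ∀ r ∈ Icc a b, |f (v₁ r) - f (v₂ r)| ≤ K * |v₁ r - v₂ r| := fun r hr =>
    hK.dist_le_mul _ (Or.inl (mem_image_of_mem _ hr)) _ (Or.inr (mem_image_of_mem _ hr))
  set N : ℝ → ℝ := fun r =>
    Real.exp (-((K + 1) * r)) * ((v₁ r - v₂ r) ^ 2 + (u₁ r - u₂ r) ^ 2) with hN
  have hanti : AntitoneOn N (Icc a b) := by
    have hderiv : ∀ r ∈ Ioo a b, HasDerivAt N
        (Real.exp (-((K + 1) * r)) * (-((K + 1) * 1)) *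
            ((v₁ r - v₂ r) ^ 2 + (u₁ r - u₂ r) ^ 2) +
          Real.exp (-((K + 1) * r)) *
            (2 * (v₁ r - v₂ r) * (u₁ r - u₂ r) +
              2 * (u₁ r - u₂ r) * ((-(((d : ℝ) - 1) / r * u₁ r) - f (v₁ r)) -
                (-(((d : ℝ) - 1) / r * u₂ r) - f (v₂ r))))) r := by
      intro r hr
      have e := ((hasDerivAt_id r).const_mul (K + 1 : ℝ)).neg.exp
      have hv' := ((h₁.hasDerivAt_fst r hr).sub (h₂.hasDerivAt_fst r hr)).pow 2
      have hu' := ((h₁.hasDerivAt_snd r hr).sub (h₂.hasDerivAt_snd r hr)).pow 2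
      have := e.mul (hv'.add hu')
      refine this.congr_deriv ?_
      simp
    refine antitoneOn_of_deriv_nonpos (convex_Icc a b) ?_ ?_ ?_
    · have := h₁.continuousOn_fst
      have := h₂.continuousOn_fst
      have := h₁.continuousOn_snd
      have := h₂.continuousOn_snd
      fun_prop
    · rw [interior_Icc]
      exact fun r hr => (hderiv r hr).differentiableAt.differentiableWithinAt
    · rw [interior_Icc]
      intro r hr
      rw [(hderiv r hr).deriv]
      have hl := hlip r (Ioo_subset_Icc_self hr)
      generalize v₁ r = x₁ at *
      generalize v₂ r = x₂ at *
      generalize u₁ r = y₁ at *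
      generalize u₂ r = y₂ at *
      have hr0 : 0 < r := ha.trans_lt hr.1
      have h1 : 0 ≤ ((d : ℝ) - 1) / r * (y₁ - y₂) ^ 2 := by positivity
      have h2 : -((y₁ - y₂) * (f x₁ - f x₂)) ≤ |y₁ - y₂| * (K * |x₁ - x₂|) :=
        (neg_le_abs _).trans (by rw [abs_mul]; gcongr)
      have h3 : (x₁ - x₂) * (y₁ - y₂) ≤ |y₁ - y₂| * |x₁ - x₂| :=
        (le_abs_self _).trans (by rw [abs_mul, mul_comm])
      have h4 : 2 * (|y₁ - y₂| * |x₁ - x₂|) ≤ (x₁ - x₂) ^ 2 + (y₁ - y₂) ^ 2 := by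
        rw [← sq_abs (x₁ - x₂), ← sq_abs (y₁ - y₂)]
        nlinarith [sq_nonneg (|x₁ - x₂| - |y₁ - y₂|)]
      have h5 : (K + 1 : ℝ) * (2 * (|y₁ - y₂| * |x₁ - x₂|)) ≤
          (K + 1) * ((x₁ - x₂) ^ 2 + (y₁ - y₂) ^ 2) := by gcongr
      rw [mul_assoc, ← mul_add]
      refine mul_nonpos_of_nonneg_of_nonpos (Real.exp_nonneg _) ?_
      have h6 : 2 * (y₁ - y₂) * (-(((d : ℝ) - 1) / r * y₁) - f x₁ -
          (-(((d : ℝ) - 1) / r * y₂) - f x₂)) =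
          -2 * (((d : ℝ) - 1) / r * (y₁ - y₂) ^ 2) - 2 * ((y₁ - y₂) * (f x₁ - f x₂)) := by ring
      rw [h6]
      linarith
  have hzero : ∀ r ∈ Icc a b, (v₁ r - v₂ r) ^ 2 + (u₁ r - u₂ r) ^ 2 ≤ 0 := by
    intro r hr
    have h := hanti ⟨le_rfl, hr.1.trans hr.2⟩ hr hr.1
    have h0 : N a = 0 := by simp [hN, hv, hu]
    rw [h0] at h
    exact nonpos_of_mul_nonpos_right h (Real.exp_pos _)
  constructor
  · intro r hr
    have := hzero r hr
    nlinarith [sq_nonneg (v₁ r - v₂ r), sq_nonneg (u₁ r - u₂ r)]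
  · intro r hr
    have := hzero r hr
    nlinarith [sq_nonneg (v₁ r - v₂ r), sq_nonneg (u₁ r - u₂ r)]

/-- The energy `v'²/2 + F(v)` is nonincreasing. -/
theorem antitoneOn_energy (hd : 1 ≤ d) (hf : Continuous f) (ha : 0 ≤ a)
    (h : IsRadialSol d f a b v u) :
    AntitoneOn (fun r => u r ^ 2 / 2 + primitive f (v r)) (Icc a b) := by
  have hd1 : (0 : ℝ) ≤ (d : ℝ) - 1 := by
    have : (1 : ℝ) ≤ d := by exact_mod_cast hd
    linarith
  have hF : Continuous (primitive f) :=
    continuous_iff_continuousAt.2 fun s => (hasDerivAt_primitive hf s).continuousAt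
  have hderiv : ∀ r ∈ Ioo a b, HasDerivAt (fun r => u r ^ 2 / 2 + primitive f (v r))
      (-(((d : ℝ) - 1) / r * u r ^ 2)) r := by
    intro r hr
    have h1 := ((h.hasDerivAt_snd r hr).pow 2).div_const 2
    have h2 := (hasDerivAt_primitive hf (v r)).comp r (h.hasDerivAt_fst r hr)
    refine (h1.add h2).congr_deriv ?_
    push_cast
    ring
  refine antitoneOn_of_deriv_nonpos (convex_Icc a b) ?_ ?_ ?_
  · have := h.continuousOn_snd
    exact ((this.pow 2).div_const 2).add (hF.comp_continuousOn h.continuousOn_fst)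
  · rw [interior_Icc]
    exact fun r hr => (hderiv r hr).differentiableAt.differentiableWithinAt
  · rw [interior_Icc]
    intro r hr
    rw [(hderiv r hr).deriv]
    have hr0 : 0 < r := ha.trans_lt hr.1
    have : 0 ≤ ((d : ℝ) - 1) / r * u r ^ 2 := by positivity
    linarith

/-- If `d F(s) < ((d-2)/2) s f(s)` for `s > 0`, the Pohozaev function
`r^d (v'²/2 + F(v)) + ((d-2)/2) r^(d-1) v v'` is strictly decreasing while `v > 0`. -/
theorem strictAntiOn_pohozaev (hd : 2 ≤ d) (hf : Continuous f)
    (hP : ∀ s, 0 < s → (d : ℝ) * primitive f s < ((d : ℝ) - 2) / 2 * (s * f s)) (ha : 0 ≤ a)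
    (h : IsRadialSol d f a b v u) (hv : ∀ r ∈ Ioo a b, 0 < v r) :
    StrictAntiOn (fun r => r ^ (d - 1) *
      (r * (u r ^ 2 / 2 + primitive f (v r)) + ((d : ℝ) - 2) / 2 * (v r * u r))) (Icc a b) := by
  have hF : Continuous (primitive f) :=
    continuous_iff_continuousAt.2 fun s => (hasDerivAt_primitive hf s).continuousAt
  refine strictAntiOn_of_deriv_neg (convex_Icc a b) ?_ ?_
  · have h1 := h.continuousOn_snd
    have h2 := h.continuousOn_fst
    have h3 := hF.comp_continuousOn h.continuousOn_fst
    exact (continuousOn_id.pow _).mul ((continuousOn_id.mul (((h1.pow 2).div_const 2).add h3)).add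
      ((h2.mul h1).const_mul _))
  · rw [interior_Icc]
    intro r hr
    have hr0 : 0 < r := ha.trans_lt hr.1
    have hv' := h.hasDerivAt_fst r hr
    have hu' := h.hasDerivAt_snd r hr
    have h1 := (hu'.pow 2).div_const 2
    have h2 := (hasDerivAt_primitive hf (v r)).comp r hv'
    have h3 := (hasDerivAt_radialWeight hd hr0.ne').mul
      (((hasDerivAt_id r).mul (h1.add h2)).add ((hv'.mul hu').const_mul (((d : ℝ) - 2) / 2)))
    have h4 : HasDerivAt (fun r => r ^ (d - 1) *
        (r * (u r ^ 2 / 2 + primitive f (v r)) + ((d : ℝ) - 2) / 2 * (v r * u r)))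
        (r ^ (d - 1) * (d * primitive f (v r) - ((d : ℝ) - 2) / 2 * (v r * f (v r)))) r := by
      refine h3.congr_deriv ?_
      simp only [radialWeight, Pi.add_apply, Pi.mul_apply, Pi.pow_apply, Function.comp, id]
      push_cast
      field_simp
      ring
    rw [h4.deriv]
    exact mul_neg_of_pos_of_neg (by positivity) (sub_neg.2 (hP _ (hv r hr)))

end IsRadialSol

/-- A solution on `[0, ∞)` cannot reach zero if the Pohozaev sign condition holds: at a first zero
`r` the Pohozaev function would be `r^d v'(r)²/2 ≥ 0`, while it starts from `0` and decreases. -/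
theorem pos_of_isRadialSol {d : ℕ} {f v u : ℝ → ℝ} (hd : 2 ≤ d) (hf : Continuous f)
    (hP : ∀ s, 0 < s → (d : ℝ) * primitive f s < ((d : ℝ) - 2) / 2 * (s * f s))
    {R : ℝ} (h : IsRadialSol d f 0 R v u) (h0 : 0 < v 0) : ∀ r ∈ Icc 0 R, 0 < v r := by
  by_contra! hcon
  obtain ⟨r, hr, hvr⟩ := hcon
  have hcl : IsCompact (Icc 0 R ∩ v ⁻¹' Iic 0) :=
    isCompact_Icc.of_isClosed_subset
      (h.continuousOn_fst.preimage_isClosed_of_isClosed isClosed_Icc isClosed_Iic)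
      inter_subset_left
  obtain ⟨z, ⟨hz, hvz⟩, hmin⟩ := hcl.exists_isLeast ⟨r, hr, hvr⟩
  have hpos : ∀ t ∈ Ico 0 z, 0 < v t := by
    intro t ht
    by_contra! hvt
    exact absurd (hmin ⟨⟨ht.1, ht.2.le.trans hz.2⟩, hvt⟩) (not_le.2 ht.2)
  have hz0 : 0 < z := lt_of_le_of_ne hz.1 fun he => absurd hvz (by simpa [← he] using h0)
  have hvz0 : v z = 0 := by
    refine le_antisymm hvz ?_
    have hc : ContinuousWithinAt v (Icc 0 z) z :=
      (h.continuousOn_fst z hz).mono (Icc_subset_Icc_right hz.2)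
    have : (𝓝[Ico 0 z] z).NeBot := by
      rw [← mem_closure_iff_nhdsWithin_neBot, closure_Ico hz0.ne]
      exact right_mem_Icc.2 hz0.le
    refine ge_of_tendsto (hc.mono Ico_subset_Icc_self).tendsto ?_
    filter_upwards [self_mem_nhdsWithin] with t ht using (hpos t ht).le
  have hanti := (h.mono le_rfl hz.2).strictAntiOn_pohozaev hd hf hP le_rfl
    fun t ht => hpos t ⟨ht.1.le, ht.2⟩
  have hlt := hanti (left_mem_Icc.2 hz0.le) (right_mem_Icc.2 hz0.le) hz0
  have h00 : primitive f 0 = 0 := intervalIntegral.integral_same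
  have hd1 : d - 1 ≠ 0 := by omega
  simp only [hvz0, h00, zero_mul, mul_zero, add_zero, zero_pow hd1] at hlt
  have : 0 ≤ z ^ (d - 1) * (z * (u z ^ 2 / 2)) := by positivity
  linarith

/-! ### Existence away from the singularity -/

/-- For a bounded Lipschitz nonlinearity, solutions exist on every compact interval to the right of
a positive initial point. -/
theorem exists_isRadialSol_of_bounded {d : ℕ} (hd : 2 ≤ d) {g : ℝ → ℝ} {K : NNReal}
    (hg : LipschitzWith K g)
    {B : ℝ} (hB : ∀ s, |g s| ≤ B) {a b : ℝ} (ha : 0 < a) (hab : a ≤ b) (v₀ u₀ : ℝ) :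
    ∃ v u : ℝ → ℝ, IsRadialSol d g a b v u ∧ v a = v₀ ∧ u a = u₀ := by
  have hb : 0 < b := ha.trans_le hab
  have hB0 : 0 ≤ B := (abs_nonneg _).trans (hB 0)
  -- In the variables `(v, w)` with `w = r^(d-1) v'` the derivative of `w` is bounded, so truncating
  -- `w` at the bound `M` does not change the solution and makes the vector field bounded.
  set M : ℝ := |a ^ (d - 1) * u₀| + b ^ (d - 1) * B * (b - a) with hM
  have hM0 : 0 ≤ M := add_nonneg (abs_nonneg _)
    (mul_nonneg (mul_nonneg (by positivity) hB0) (sub_nonneg.2 hab))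
  set c : ℝ → ℝ := fun x => max (-M) (min x M) with hc
  have hcM : ∀ x, |c x| ≤ M := fun x =>
    abs_le.2 ⟨le_max_left _ _, max_le (by linarith) (min_le_right _ _)⟩
  have hcid : ∀ x, |x| ≤ M → c x = x := fun x hx => by
    rw [hc]
    simp only [min_eq_left (abs_le.1 hx).2, max_eq_right (abs_le.1 hx).1]
  have hclip : LipschitzWith 1 c := (LipschitzWith.id.min_const M).const_max (-M)
  let X : ℝ → ℝ × ℝ → ℝ × ℝ := fun t x => (c x.2 / t ^ (d - 1), -(t ^ (d - 1) * g x.1))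
  have hpow : ∀ t ∈ Icc a b, a ^ (d - 1) ≤ t ^ (d - 1) ∧ t ^ (d - 1) ≤ b ^ (d - 1) := fun t ht =>
    ⟨pow_le_pow_left₀ ha.le ht.1 _, pow_le_pow_left₀ (ha.le.trans ht.1) ht.2 _⟩
  have ha' : 0 < a ^ (d - 1) := by positivity
  have hb' : 0 < b ^ (d - 1) := by positivity
  have hL0 : 0 ≤ max (M / a ^ (d - 1)) (b ^ (d - 1) * B) := le_max_of_le_left (by positivity)
  have hK0 : 0 ≤ max (1 / a ^ (d - 1)) (b ^ (d - 1) * K) := le_max_of_le_left (by positivity)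
  obtain ⟨L, hL⟩ : ∃ L : NNReal, (L : ℝ) = max (M / a ^ (d - 1)) (b ^ (d - 1) * B) :=
    ⟨_, Real.coe_toNNReal _ hL0⟩
  obtain ⟨K', hK'⟩ : ∃ K' : NNReal, (K' : ℝ) = max (1 / a ^ (d - 1)) (b ^ (d - 1) * K) :=
    ⟨_, Real.coe_toNNReal _ hK0⟩
  have hX : IsPicardLindelof X (⟨a, left_mem_Icc.2 hab⟩ : Icc a b) (v₀, a ^ (d - 1) * u₀)
      (L * Real.toNNReal (b - a)) 0 L K' := by
    refine ⟨fun t ht => ?_, fun x _ => ?_, fun t ht x _ => ?_, ?_⟩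
    · refine LipschitzOnWith.of_dist_le_mul fun x _ y _ => ?_
      rw [hK']
      obtain ⟨h1, h2⟩ := hpow t ht
      have hx1 : dist x.1 y.1 ≤ dist x y := le_max_left _ _
      have hx2 : dist x.2 y.2 ≤ dist x y := le_max_right _ _
      refine max_le ?_ ?_
      · have h3 : |c x.2 - c y.2| ≤ dist x y :=
          ((hclip.dist_le_mul x.2 y.2).trans_eq (by simp)).trans hx2
        calc dist (c x.2 / t ^ (d - 1)) (c y.2 / t ^ (d - 1))
            = |c x.2 - c y.2| / t ^ (d - 1) := by
              rw [Real.dist_eq, ← sub_div, abs_div, abs_of_pos (ha'.trans_le h1)]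
          _ ≤ dist x y / a ^ (d - 1) := by gcongr
          _ = 1 / a ^ (d - 1) * dist x y := by ring
          _ ≤ _ := mul_le_mul_of_nonneg_right (le_max_left _ _) dist_nonneg
      · have h3 : |g x.1 - g y.1| ≤ K * dist x y :=
          (hg.dist_le_mul x.1 y.1).trans (by gcongr)
        calc dist (-(t ^ (d - 1) * g x.1)) (-(t ^ (d - 1) * g y.1))
            = t ^ (d - 1) * |g x.1 - g y.1| := by
              rw [dist_neg_neg, Real.dist_eq, ← mul_sub, abs_mul, abs_of_pos (ha'.trans_le h1)]
          _ ≤ b ^ (d - 1) * (K * dist x y) := by gcongr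
          _ = b ^ (d - 1) * K * dist x y := by ring
          _ ≤ _ := mul_le_mul_of_nonneg_right (le_max_right _ _) dist_nonneg
    · refine ContinuousOn.prodMk ?_ ?_
      · exact continuousOn_const.div (by fun_prop) fun t ht => (ha'.trans_le (hpow t ht).1).ne'
      · fun_prop
    · obtain ⟨h1, h2⟩ := hpow t ht
      rw [hL]
      refine max_le_max ?_ ?_
      · change ‖c x.2 / t ^ (d - 1)‖ ≤ _
        rw [norm_div, Real.norm_eq_abs, Real.norm_eq_abs, abs_of_pos (ha'.trans_le h1)]
        have := hcM x.2
        gcongr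
      · change ‖-(t ^ (d - 1) * g x.1)‖ ≤ _
        rw [norm_neg, norm_mul, Real.norm_eq_abs, Real.norm_eq_abs, abs_of_pos (ha'.trans_le h1)]
        have := hB x.1
        gcongr
    · have : max (b - a) (a - a) = b - a := by
        rw [sub_self, max_eq_left (sub_nonneg.2 hab)]
      rw [NNReal.coe_mul, NNReal.coe_zero, sub_zero, Real.coe_toNNReal _ (sub_nonneg.2 hab)]
      exact mul_le_mul_of_nonneg_left this.le L.coe_nonneg
  obtain ⟨α, hα0, hα⟩ := hX.exists_eq_forall_mem_Icc_hasDerivWithinAt₀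
  have hv : ∀ t ∈ Icc a b, HasDerivWithinAt (fun t => (α t).1) (c (α t).2 / t ^ (d - 1))
      (Icc a b) t := fun t ht => (hα t ht).fst
  have hw : ∀ t ∈ Icc a b, HasDerivWithinAt (fun t => (α t).2) (-(t ^ (d - 1) * g (α t).1))
      (Icc a b) t := fun t ht => (hα t ht).snd
  have hwM : ∀ t ∈ Icc a b, |(α t).2| ≤ M := by
    intro t ht
    have h1 := norm_image_sub_le_of_norm_deriv_le_segment' hw (C := b ^ (d - 1) * B) (by
      intro s hs
      obtain ⟨h1, h2⟩ := hpow s (Ico_subset_Icc_self hs)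
      rw [norm_neg, norm_mul, Real.norm_eq_abs, Real.norm_eq_abs, abs_of_pos (ha'.trans_le h1)]
      have := hB (α s).1
      gcongr) t ht
    have h2 : (α a).2 = a ^ (d - 1) * u₀ := by rw [hα0]
    rw [h2, Real.norm_eq_abs] at h1
    have h3 : b ^ (d - 1) * B * (t - a) ≤ b ^ (d - 1) * B * (b - a) := by
      have := ht.2
      gcongr
    have h4 := abs_sub_abs_le_abs_sub (α t).2 (a ^ (d - 1) * u₀)
    linarith
  refine ⟨fun t => (α t).1, fun t => (α t).2 / t ^ (d - 1), ⟨?_, ?_, ?_, ?_⟩, ?_, ?_⟩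
  · exact fun t ht => (hv t ht).continuousWithinAt
  · exact ContinuousOn.div (fun t ht => (hw t ht).continuousWithinAt) (by fun_prop)
      fun t ht => (ha'.trans_le (hpow t ht).1).ne'
  · intro t ht
    have h := (hv t (Ioo_subset_Icc_self ht)).hasDerivAt (Icc_mem_nhds ht.1 ht.2)
    rwa [hcid _ (hwM t (Ioo_subset_Icc_self ht))] at h
  · intro t ht
    have ht0 : 0 < t := ha.trans ht.1
    have h := ((hw t (Ioo_subset_Icc_self ht)).hasDerivAt (Icc_mem_nhds ht.1 ht.2)).div
      (hasDerivAt_radialWeight hd ht0.ne') (pow_pos ht0 _).ne'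
    refine h.congr_deriv ?_
    simp only [radialWeight]
    field_simp
    ring
  · simp [hα0]
  · simp only [hα0]
    field_simp

/-! ### Global existence -/

/-- A solution near `r = 0` that starts from its maximal value `l` extends to every compact
interval: beyond the starting interval the equation with `f` truncated outside `[-l, l]` is solved,
and the energy confines the solution to `[-l, l]`, where the truncation has no effect. -/
theorem IsRadialSol.exists_extension {d : ℕ} (hd : 2 ≤ d) {f : ℝ → ℝ} (hodd : Function.Odd f)
    (hf : LocallyLipschitz f) {l c : ℝ} (hl : 0 < l) (hfl : 0 < f l) (hc : 0 < c) {v₁ u₁ : ℝ → ℝ}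
    (h₁ : IsRadialSol d f 0 c v₁ u₁) (hv₁ : v₁ 0 = l) (hu₁ : u₁ 0 = 0)
    (hbd : ∀ r ∈ Icc 0 c, |v₁ r| ≤ l) (R : ℝ) :
    ∃ v u, IsRadialSol d f 0 R v u ∧ v 0 = l ∧ u 0 = 0 := by
  set t : ℝ → ℝ := fun x => max (-l) (min x l) with ht
  have htl : ∀ x, |t x| ≤ l := fun x =>
    abs_le.2 ⟨le_max_left _ _, max_le (by linarith) (min_le_right _ _)⟩
  have htid : ∀ x, |x| ≤ l → t x = x := fun x hx => by
    simp only [ht, min_eq_left (abs_le.1 hx).2, max_eq_right (abs_le.1 hx).1]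
  have htlip : LipschitzWith 1 t := (LipschitzWith.id.min_const l).const_max (-l)
  have htodd : ∀ x, t (-x) = -t x := by
    intro x
    simp only [ht]
    rcases le_total x l with h1 | h1 <;> rcases le_total (-l) x with h2 | h2 <;>
      simp only [min_def, max_def] <;> split_ifs <;> linarith
  set g : ℝ → ℝ := f ∘ t with hg
  have hgodd : Function.Odd g := fun x => by simp only [hg, Function.comp, htodd, hodd (t x)]
  have hgf : ∀ x, |x| ≤ l → g x = f x := fun x hx => by simp only [hg, Function.comp, htid x hx]
  obtain ⟨K, hK⟩ := hf.locallyLipschitzOn.exists_lipschitzOnWith_of_compact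
    (isCompact_Icc (a := -l) (b := l))
  have hglip : LipschitzWith K g := by
    have := hK.comp (htlip.lipschitzOnWith (s := univ)) fun x _ => abs_le.1 (htl x)
    rwa [mul_one, lipschitzOnWith_univ] at this
  obtain ⟨B, hB⟩ := (isCompact_Icc (a := -l) (b := l)).exists_bound_of_continuousOn
    hf.continuous.continuousOn
  have hgB : ∀ x, |g x| ≤ B := fun x => hB (t x) (abs_le.1 (htl x))
  have hconf : ∀ x, primitive g x ≤ primitive g l → |x| ≤ l := by
    intro x hx
    by_contra! hlx
    have hxabs : primitive g |x| = primitive g x := by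
      rcases abs_choice x with h | h <;> rw [h]
      exact primitive_neg_of_odd hgodd x
    rw [← hxabs] at hx
    have hmono : StrictMonoOn (primitive g) (Ici l) := by
      refine strictMonoOn_of_deriv_pos (convex_Ici l) ?_ ?_
      · exact fun s _ =>
          (hasDerivAt_primitive hglip.continuous s).continuousAt.continuousWithinAt
      · rw [interior_Ici]
        intro s hs
        have : t s = l := by
          simp only [ht, min_eq_right (mem_Ioi.1 hs).le]
          exact max_eq_right (by linarith)
        rw [(hasDerivAt_primitive hglip.continuous s).deriv]
        simpa only [hg, Function.comp, this] using hfl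
    exact absurd hx (not_le.2 (hmono self_mem_Ici hlx.le hlx))
  have h₁g : IsRadialSol d g 0 c v₁ u₁ := h₁.congr_nonlinearity fun r hr =>
    hgf _ (hbd r (Ioo_subset_Icc_self hr))
  -- The continuation starts at `c / 2`, so that the two pieces overlap and no derivative has to be
  -- matched at the point `c` where they are joined.
  have hc2 : c / 2 ≤ max R c := by
    have := le_max_right R c
    linarith
  obtain ⟨v₂, u₂, h₂, hv₂, hu₂⟩ := exists_isRadialSol_of_bounded hd hglip hgB (half_pos hc) hc2
    (v₁ (c / 2)) (u₁ (c / 2))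
  have hov := (h₁g.mono (half_pos hc).le le_rfl).eqOn (by omega) hglip.locallyLipschitz
    (half_pos hc).le (h₂.mono le_rfl (le_max_right R c)) hv₂.symm hu₂.symm
  set v : ℝ → ℝ := fun r => if r ≤ c then v₁ r else v₂ r with hv
  set u : ℝ → ℝ := fun r => if r ≤ c then u₁ r else u₂ r with hu
  have hsol₁ : IsRadialSol d g 0 c v u :=
    h₁g.congr (fun r hr => if_pos hr.2) (fun r hr => if_pos hr.2)
  have hsol₂ : IsRadialSol d g (c / 2) (max R c) v u := by
    refine h₂.congr (fun r hr => ?_) (fun r hr => ?_)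
    · by_cases hrc : r ≤ c
      · exact (if_pos hrc).trans (hov.1 ⟨hr.1, hrc⟩)
      · exact if_neg hrc
    · by_cases hrc : r ≤ c
      · exact (if_pos hrc).trans (hov.2 ⟨hr.1, hrc⟩)
      · exact if_neg hrc
  have hsol : IsRadialSol d g 0 (max R c) v u :=
    hsol₁.union hsol₂ (half_pos hc).le (half_lt_self hc) (le_max_right _ _)
  have hv0 : v 0 = l := (if_pos hc.le).trans hv₁
  have hu0 : u 0 = 0 := (if_pos hc.le).trans hu₁
  refine ⟨v, u, (hsol.congr_nonlinearity fun r hr => ?_).mono le_rfl (le_max_left R c), hv0, hu0⟩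
  have hE := hsol.antitoneOn_energy (by omega) hglip.continuous le_rfl
    (left_mem_Icc.2 (hr.1.trans hr.2).le) (Ioo_subset_Icc_self hr) hr.1.le
  simp only [hv0, hu0] at hE
  refine (hgf _ (hconf _ ?_)).symm
  have := sq_nonneg (u r)
  linarith

/-- Solutions on all intervals `[0, R]` with common initial data are restrictions of one global
solution. -/
theorem exists_global_of_forall_exists {d : ℕ} (hd : 1 ≤ d) {f : ℝ → ℝ} (hf : LocallyLipschitz f)
    {l m : ℝ} (h : ∀ R, ∃ v u, IsRadialSol d f 0 R v u ∧ v 0 = l ∧ u 0 = m) :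
    ∃ v u, (∀ R, IsRadialSol d f 0 R v u) ∧ v 0 = l ∧ u 0 = m := by
  choose V U hVU hV hU using h
  have hagree : ∀ R, EqOn (fun r => V r r) (V R) (Icc 0 R) ∧
      EqOn (fun r => U r r) (U R) (Icc 0 R) := by
    have key : ∀ R, ∀ r ∈ Icc 0 R, V r r = V R r ∧ U r r = U R r := by
      intro R r hr
      have := (hVU r).eqOn hd hf le_rfl ((hVU R).mono le_rfl hr.2) ((hV r).trans (hV R).symm)
        ((hU r).trans (hU R).symm)
      exact ⟨this.1 ⟨hr.1, le_rfl⟩, this.2 ⟨hr.1, le_rfl⟩⟩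
    exact fun R => ⟨fun r hr => (key R r hr).1, fun r hr => (key R r hr).2⟩
  exact ⟨fun r => V r r, fun r => U r r,
    fun R => (hVU R).congr (hagree R).1 (hagree R).2, hV 0, hU 0⟩

/-! ### Radial solutions and the initial value problem -/

lemma IsIVPSolution.of_isRadialSol {d : ℕ} (hd : 2 ≤ d) {f v u : ℝ → ℝ} (hf : Continuous f) {l : ℝ}
    (h : ∀ R, IsRadialSol d f 0 R v u) (hv0 : v 0 = l) (hu0 : u 0 = 0) :
    IsIVPSolution 2 (radialWeight d) f l v := by
  have hv' : ∀ r > 0, HasDerivAt v (u r) r := fun r hr =>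
    (h (r + 1)).hasDerivAt_fst r ⟨hr, by linarith⟩
  have hu' : ∀ r > 0, HasDerivAt u (-(((d : ℝ) - 1) / r * u r) - f (v r)) r := fun r hr =>
    (h (r + 1)).hasDerivAt_snd r ⟨hr, by linarith⟩
  have hIcc : ∀ r : ℝ, 0 ≤ r → Icc 0 (r + 1) ∈ 𝓝[Ici 0] r := fun r hr => by
    rw [← Ici_inter_Iic]
    exact inter_mem_nhdsWithin _ (Iic_mem_nhds (by linarith))
  have hvc : ContinuousOn v (Ici 0) := fun r hr =>
    ((h (r + 1)).continuousOn_fst r ⟨hr, by linarith⟩).mono_of_mem_nhdsWithin (hIcc r hr)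
  have huc : ContinuousOn u (Ici 0) := fun r hr =>
    ((h (r + 1)).continuousOn_snd r ⟨hr, by linarith⟩).mono_of_mem_nhdsWithin (hIcc r hr)
  have hv0' : HasDerivWithinAt v (u 0) (Ici 0) 0 := by
    refine hasDerivWithinAt_Ici_of_tendsto_deriv (s := Ioi 0)
      (fun r hr => (hv' r hr).differentiableAt.differentiableWithinAt)
      ((hvc 0 self_mem_Ici).mono Ioi_subset_Ici_self) self_mem_nhdsWithin ?_
    refine ((huc 0 self_mem_Ici).mono Ioi_subset_Ici_self).tendsto.congr' ?_
    filter_upwards [self_mem_nhdsWithin] with r hr using (hv' r hr).deriv.symm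
  have hvw : ∀ r ∈ Ici (0 : ℝ), HasDerivWithinAt v (u r) (Ici 0) r := by
    intro r hr
    rcases (mem_Ici.1 hr).eq_or_lt with rfl | h0
    · exact hv0'
    · exact (hv' r h0).hasDerivWithinAt
  have hflux : EqOn (fun r => radialWeight d r * phi 2 (deriv v r))
      (fun r => radialWeight d r * u r) (Ioi 0) := fun r hr => by
    simp only [phi_two, (hv' r hr).deriv]
  have hflux' : ∀ r > 0, HasDerivAt (fun r => radialWeight d r * phi 2 (deriv v r))
      (-(radialWeight d r * f (v r))) r := by
    intro r hr
    refine HasDerivAt.congr_of_eventuallyEq ?_ (hflux.eventuallyEq_of_mem (Ioi_mem_nhds hr))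
    refine ((hasDerivAt_radialWeight hd hr.ne').mul (hu' r hr)).congr_deriv ?_
    simp only [radialWeight]
    ring
  refine ⟨?_, ?_, fun r hr => ?_, hv0, ?_⟩
  · rw [contDiffOn_one_iff_derivWithin (uniqueDiffOn_Ici 0)]
    exact ⟨fun r hr => (hvw r hr).differentiableWithinAt,
      huc.congr fun r hr => (hvw r hr).derivWithin (uniqueDiffOn_Ici 0 r hr)⟩
  · rw [contDiffOn_one_iff_derivWithin isOpen_Ioi.uniqueDiffOn]
    refine ⟨fun r hr => (hflux' r hr).differentiableAt.differentiableWithinAt, ?_⟩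
    have hc : ContinuousOn (fun r => -(radialWeight d r * f (v r))) (Ioi 0) :=
      (((continuous_id.pow (d - 1)).continuousOn).mul
        (hf.comp_continuousOn (hvc.mono Ioi_subset_Ici_self))).neg
    exact hc.congr fun r hr => by
      rw [derivWithin_of_isOpen isOpen_Ioi hr, (hflux' r hr).deriv]
  · rw [(hflux' r hr).deriv]
    ring
  · rw [hv0'.derivWithin (uniqueDiffOn_Ici 0 0 self_mem_Ici), hu0]

lemma IsIVPSolution.isRadialSol {d : ℕ} (hd : 2 ≤ d) {f w : ℝ → ℝ} {l : ℝ}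
    (h : IsIVPSolution 2 (radialWeight d) f l w) (R : ℝ) :
    IsRadialSol d f 0 R w (derivWithin w (Ici 0)) := by
  obtain ⟨hdiff, hcont⟩ := (contDiffOn_one_iff_derivWithin (uniqueDiffOn_Ici 0)).1 h.contDiffOn
  have hder : ∀ r > 0, derivWithin w (Ici 0) r = deriv w r := fun r hr =>
    derivWithin_of_mem_nhds (Ici_mem_nhds hr)
  refine ⟨hdiff.continuousOn.mono Icc_subset_Ici_self, hcont.mono Icc_subset_Ici_self,
    fun r hr => ?_, fun r hr => ?_⟩
  · rw [hder r hr.1]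
    exact ((hdiff r hr.1.le).differentiableAt (Ici_mem_nhds hr.1)).hasDerivAt
  · have hflux := (((h.flux_contDiffOn.differentiableOn one_ne_zero) r hr.1).differentiableAt
      (Ioi_mem_nhds hr.1)).hasDerivAt
    have heq := h.equation r hr.1
    have hq := hasDerivAt_radialWeight hd hr.1.ne'
    have hq0 : radialWeight d r ≠ 0 := (pow_pos hr.1 _).ne'
    have hfun : derivWithin w (Ici 0) =ᶠ[𝓝 r]
        fun t => radialWeight d t * phi 2 (deriv w t) / radialWeight d t := by
      filter_upwards [Ioi_mem_nhds hr.1] with t ht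
      have : radialWeight d t ≠ 0 := (pow_pos ht _).ne'
      rw [hder t ht, phi_two, mul_div_cancel_left₀ _ this]
    refine ((hflux.div hq hq0).congr_of_eventuallyEq hfun).congr_deriv ?_
    rw [eq_neg_of_add_eq_zero_left heq, hder r hr.1, phi_two]
    have hr0 : r ≠ 0 := hr.1.ne'
    simp only [radialWeight] at hq0 ⊢
    field_simp
    ring

/-! ### The Aubin–Talenti bubble -/

/-- The profile `l (1 + k r²)^(-(d-2)/2)` with `k = l^(2*-2)/(d(d-2))`, which solves the equation
with the pure critical power `v^(2*-1)` and takes its maximal value `l` at `r = 0`. -/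
noncomputable def bubble (d : ℕ) (l r : ℝ) : ℝ :=
  l * (1 + l ^ (twoStar d - 2) / (d * (d - 2)) * r ^ 2) ^ (-(((d : ℝ) - 2) / 2))

/-- The derivative of `bubble` in `r`. -/
noncomputable def bubbleDeriv (d : ℕ) (l r : ℝ) : ℝ :=
  -(l ^ (twoStar d - 1) / d * r *
    (1 + l ^ (twoStar d - 2) / (d * (d - 2)) * r ^ 2) ^ (-((d : ℝ) / 2)))

section Bubble

variable {d : ℕ} {l : ℝ}

lemma two_lt_twoStar (hd : 3 ≤ d) : 2 < twoStar d := by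
  have : (3 : ℝ) ≤ d := by exact_mod_cast hd
  rw [twoStar, lt_div_iff₀ (by linarith)]
  linarith

lemma one_le_bubble_base (hd : 3 ≤ d) (hl : 0 < l) (r : ℝ) :
    1 ≤ 1 + l ^ (twoStar d - 2) / (d * (d - 2)) * r ^ 2 := by
  have : (3 : ℝ) ≤ d := by exact_mod_cast hd
  have : (0 : ℝ) < d - 2 := by linarith
  have : 0 ≤ l ^ (twoStar d - 2) / (d * (d - 2)) * r ^ 2 := by positivity
  linarith

lemma bubble_pos (hd : 3 ≤ d) (hl : 0 < l) (r : ℝ) : 0 < bubble d l r :=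
  mul_pos hl (Real.rpow_pos_of_pos (one_pos.trans_le (one_le_bubble_base hd hl r)) _)

lemma bubble_le (hd : 3 ≤ d) (hl : 0 < l) (r : ℝ) : bubble d l r ≤ l := by
  have : (3 : ℝ) ≤ d := by exact_mod_cast hd
  exact mul_le_of_le_one_right hl.le
    (Real.rpow_le_one_of_one_le_of_nonpos (one_le_bubble_base hd hl r) (by linarith))

lemma bubble_zero : bubble d l 0 = l := by
  simp [bubble]

lemma bubbleDeriv_zero : bubbleDeriv d l 0 = 0 := by
  simp [bubbleDeriv]

lemma hasDerivAt_bubble (hd : 3 ≤ d) (hl : 0 < l) (r : ℝ) :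
    HasDerivAt (bubble d l) (bubbleDeriv d l r) r := by
  have hd3 : (3 : ℝ) ≤ d := by exact_mod_cast hd
  have hd2 : (d : ℝ) - 2 ≠ 0 := by linarith
  have hd0 : (d : ℝ) ≠ 0 := by linarith
  have hA := one_pos.trans_le (one_le_bubble_base hd hl r)
  have hA' := (((hasDerivAt_id r).pow 2).const_mul
    (l ^ (twoStar d - 2) / (d * (d - 2)))).const_add 1
  refine ((hA'.rpow_const (p := -(((d : ℝ) - 2) / 2)) (Or.inl hA.ne')).const_mul l).congr_deriv ?_
  have he : -(((d : ℝ) - 2) / 2) - 1 = -((d : ℝ) / 2) := by ring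
  have hll : l ^ (twoStar d - 1) = l ^ (twoStar d - 2) * l := by
    rw [← Real.rpow_add_one hl.ne']
    ring_nf
  simp only [bubbleDeriv, Pi.pow_apply, id, he, hll]
  push_cast
  field_simp

lemma hasDerivAt_bubbleDeriv (hd : 3 ≤ d) (hl : 0 < l) {r : ℝ} (hr : r ≠ 0) :
    HasDerivAt (bubbleDeriv d l)
      (-(((d : ℝ) - 1) / r * bubbleDeriv d l r) - bubble d l r ^ (twoStar d - 1)) r := by
  have hd3 : (3 : ℝ) ≤ d := by exact_mod_cast hd
  have hd2 : (d : ℝ) - 2 ≠ 0 := by linarith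
  have hd0 : (d : ℝ) ≠ 0 := by linarith
  have hA := one_pos.trans_le (one_le_bubble_base hd hl r)
  have hA' := (((hasDerivAt_id r).pow 2).const_mul
    (l ^ (twoStar d - 2) / (d * (d - 2)))).const_add 1
  refine (((hasDerivAt_id r).const_mul (l ^ (twoStar d - 1) / d)).mul
    (hA'.rpow_const (p := -((d : ℝ) / 2)) (Or.inl hA.ne'))).neg.congr_deriv ?_
  -- The exponents match because `(d-2)/2 * (2* - 1) = d/2 + 1`.
  have hpow : bubble d l r ^ (twoStar d - 1) = l ^ (twoStar d - 1) *
      (1 + l ^ (twoStar d - 2) / (d * (d - 2)) * r ^ 2) ^ (-((d : ℝ) / 2) - 1) := by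
    rw [bubble, Real.mul_rpow hl.le (Real.rpow_nonneg hA.le _), ← Real.rpow_mul hA.le]
    congr 2
    rw [twoStar]
    field_simp
    ring
  have hstep : (1 + l ^ (twoStar d - 2) / (d * (d - 2)) * r ^ 2) ^ (-((d : ℝ) / 2)) =
      (1 + l ^ (twoStar d - 2) / (d * (d - 2)) * r ^ 2) ^ (-((d : ℝ) / 2) - 1) *
        (1 + l ^ (twoStar d - 2) / (d * (d - 2)) * r ^ 2) := by
    rw [← Real.rpow_add_one hA.ne']
    ring_nf
  rw [hpow]
  simp only [bubbleDeriv, Pi.pow_apply, id, hstep]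
  generalize (1 + l ^ (twoStar d - 2) / (d * (d - 2)) * r ^ 2) ^ (-((d : ℝ) / 2) - 1) = A
  push_cast
  field_simp
  ring

/-- As long as the bubble stays above `β`, it solves the equation with the modified
nonlinearity. -/
lemma isRadialSol_bubble (hd : 3 ≤ d) {β c : ℝ} (hβ : 0 < β) (hl : 0 < l)
    (hb : ∀ r ∈ Ioo 0 c, β ≤ bubble d l r) :
    IsRadialSol d (glueNonlinearity (twoStar d) β) 0 c (bubble d l) (bubbleDeriv d l) where
  continuousOn_fst r _ := (hasDerivAt_bubble hd hl r).continuousAt.continuousWithinAt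
  continuousOn_snd := by
    refine Continuous.continuousOn ?_
    unfold bubbleDeriv
    have : Continuous fun r : ℝ =>
        (1 + l ^ (twoStar d - 2) / (d * (d - 2)) * r ^ 2) ^ (-((d : ℝ) / 2)) :=
      Continuous.rpow_const (by fun_prop) fun r =>
        Or.inl (one_pos.trans_le (one_le_bubble_base hd hl r)).ne'
    fun_prop
  hasDerivAt_fst r _ := hasDerivAt_bubble hd hl r
  hasDerivAt_snd r hr := by
    rw [glueNonlinearity_of_le (two_lt_twoStar hd) hβ (hb r hr)]
    exact hasDerivAt_bubbleDeriv hd hl hr.1.ne'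

end Bubble

/-- Every datum above `β` launches a global radial solution. -/
theorem exists_global_isRadialSol {d : ℕ} (hd : 3 ≤ d) {β l : ℝ} (hβ : 0 < β) (hl : β < l) :
    ∃ v u, (∀ R, IsRadialSol d (glueNonlinearity (twoStar d) β) 0 R v u) ∧
      v 0 = l ∧ u 0 = 0 := by
  have hl0 : 0 < l := hβ.trans hl
  have hp := two_lt_twoStar hd
  have hcont : ContinuousAt (bubble d l) 0 := (hasDerivAt_bubble hd hl0 0).continuousAt
  obtain ⟨c, hc, hcb⟩ := Metric.eventually_nhds_iff.1
    (hcont.eventually_const_lt (u := β) (by rwa [bubble_zero]))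
  have hb : ∀ r ∈ Ioo 0 c, β ≤ bubble d l r := fun r hr =>
    (hcb (by rw [Real.dist_eq, sub_zero, abs_of_pos hr.1]; exact hr.2)).le
  refine exists_global_of_forall_exists (by omega) (locallyLipschitz_glueNonlinearity hp) ?_
  refine (isRadialSol_bubble hd hβ hl0 hb).exists_extension (by omega) odd_glueNonlinearity
    (locallyLipschitz_glueNonlinearity hp) hl0
    ((condF2_glueNonlinearity hp hβ).pos_right l hl.le) hc bubble_zero bubbleDeriv_zero ?_
  intro r _
  rw [abs_of_pos (bubble_pos hd hl0 r)]
  exact bubble_le hd hl0 r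

end RadialShooting

/-! ### The counterexample -/

theorem mainTheorem4 (d : ℕ) (hd : 3 ≤ d) (β : ℝ) (hβ : 0 < β) :
    (RadialShooting.CondQ1 (RadialShooting.radialWeight d) ∧
      RadialShooting.CondQ2 (RadialShooting.radialWeight d) ∧
      RadialShooting.CondQ3 (RadialShooting.radialWeight d) ∧
      RadialShooting.CondQ4 2 (RadialShooting.radialWeight d)) ∧
    ∃ f : ℝ → ℝ,
      Function.Odd f ∧
      (∀ s : ℝ, β ≤ |s| → f s = |s| ^ (RadialShooting.twoStar d - 2) * s) ∧
      RadialShooting.CondF1 f ∧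
      RadialShooting.CondF2 f (-β) β ∧
      ¬ RadialShooting.CondSC 2 (RadialShooting.radialWeight d) f ∧
      ∃ l₀ : ℝ, β < l₀ ∧ ∀ l : ℝ, l₀ ≤ l →
        ∃ v : ℝ → ℝ,
          RadialShooting.IsIVPSolution 2 (RadialShooting.radialWeight d) f l v ∧
          (∀ w : ℝ → ℝ, RadialShooting.IsIVPSolution 2 (RadialShooting.radialWeight d) f l w →
            Set.EqOn w v (Set.Ici 0)) ∧
          ∀ r : ℝ, 0 ≤ r → 0 < v r := by
  open RadialShooting in
  have hd2 : 2 ≤ d := by omega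
  have hd3 : (3 : ℝ) ≤ d := by exact_mod_cast hd
  have hdm : (0 : ℝ) < d - 2 := by linarith
  have hp := two_lt_twoStar hd
  have hlip := locallyLipschitz_glueNonlinearity (β := β) hp
  have hF2 := condF2_glueNonlinearity hp hβ
  refine ⟨⟨condQ1_radialWeight hd2, condQ2_radialWeight hd2, condQ3_radialWeight hd2,
    condQ4_radialWeight hd2⟩, glueNonlinearity (twoStar d) β, odd_glueNonlinearity,
    fun s hs => glueNonlinearity_of_le_abs hβ hs, condF1_glueNonlinearity hp, hF2, ?_,
    β + 1, by linarith, fun l hl => ?_⟩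
  · refine not_condSC_of_primitive_le hd2 hβ hF2.pos_right fun s hs => ?_
    have h := primitive_glueNonlinearity_lt hp hβ (hβ.trans_le hs)
    -- `μ* = 1/2 - 1/d = 1/2*`, so the Pohozaev inequality is exactly what is needed.
    have hmu : (1 / 2 - 1 / d : ℝ) = 1 / twoStar d := by
      rw [twoStar]
      field_simp
    rw [hmu, mul_assoc, one_div_mul_eq_div, le_div_iff₀' (by linarith)]
    exact h.le
  · have hP : ∀ s, 0 < s → (d : ℝ) * primitive (glueNonlinearity (twoStar d) β) s <
        ((d : ℝ) - 2) / 2 * (s * glueNonlinearity (twoStar d) β s) := by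
      intro s hs
      have h := mul_lt_mul_of_pos_left (primitive_glueNonlinearity_lt hp hβ hs) (half_pos hdm)
      refine lt_of_eq_of_lt ?_ h
      rw [← mul_assoc]
      congr 1
      rw [twoStar]
      field_simp
    obtain ⟨v, u, hsol, hv0, hu0⟩ := exists_global_isRadialSol hd hβ (show β < l by linarith)
    refine ⟨v, .of_isRadialSol hd2 hlip.continuous hsol hv0 hu0, fun w hw r hr => ?_,
      fun r hr => ?_⟩
    · exact ((hw.isRadialSol hd2 r).eqOn (by omega) hlip le_rfl (hsol r)
        (hw.init_value.trans hv0.symm) (hw.init_deriv.trans hu0.symm)).1 ⟨hr, le_rfl⟩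
    · exact pos_of_isRadialSol hd2 hlip.continuous hP (hsol r) (by linarith) r ⟨hr, le_rfl⟩
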